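/- Let $-\infty<a<b<\infty$ and let $p,q,r$ be real-valued functions on $(a,b)$ with $r>0$ and $p>0$ a.e. and $r,\,1/p,\,q\in L^1((a,b);dx)$. Write $y^{[1]}=py'$ and $\tau y=\frac1r\big(-(y^{[1]})'+qy\big)$, and let $(\cdot,\cdot)$ be the inner product of $L^2((a,b);r\,dx)$ (linear in the second argument). Let $H_{\max}f=\tau f$ with domain $\{g\in L^2((a,b);r\,dx): g,g^{[1]}\in AC([a,b]),\ \tau g\in L^2((a,b);r\,dx)\}$, let $H_{\min}$ be its restriction to the functions with $g(a)=g^{[1]}(a)=g(b)=g^{[1]}(b)=0$, and for $\theta_a,\theta_b\in[0,\pi)$ let $H_{\theta_a,\theta_b}$ be its restriction to the functions with $$\cos(\theta_a)g(a)+\sin(\theta_a)g^{[1]}(a)=0,\qquad \cos(\theta_b)g(b)-\sin(\theta_b)g^{[1]}(b)=0 .$$ Thus $H_{0,0}$ is the Dirichlet operator. The maximal common part of two operators $A_1,A_2$ is the operator $f\mapsto A_1f$ on $\{f\in\operatorname{dom}(A_1)\cap\operatorname{dom}(A_2): A_1f=A_2f\}$. $\rho(\cdot)$ denotes the resolvent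 set. For each $z\in\rho(H_{0,0})$ the space $\ker(H_{\max}-z)$ has a basis $u_1(z,\cdot),u_2(z,\cdot)$ determined by $$u_1(z,a)=0,\quad u_1(z,b)=1,\quad u_2(z,a)=1,\quad u_2(z,b)=0 .$$ With this notation the following hold. (i) If $\theta_a\neq0$ and $\theta_b\neq0$, then the maximal common part of $H_{\theta_a,\theta_b}$ and $H_{0,0}$ is $H_{\min}$. For every $z\in\rho(H_{\theta_a,\theta_b})\cap\rho(H_{0,0})$ the matrix $$D_{\theta_a,\theta_b}(z)=\begin{pmatrix}\cot(\theta_b)-u_1^{[1]}(z,b)&-u_2^{[1]}(z,b)\\ u_1^{[1]}(z,a)&\cot(\theta_a)+u_2^{[1]}(z,a)\end{pmatrix}$$ is invertible and $$(H_{\theta_a,\theta_b}-z)^{-1}=(H_{0,0}-z)^{-1}-\sum_{j,k=1}^2\big(D_{\theta_a,\theta_b}(z)^{-1}\big)_{j,k}\,(u_k(\overline z,\cdot),\cdot)\,u_j(z,\cdot).$$ (ii) If $\theta_a\neq0$, then the maximal common part of $H_{\theta_a,0}$ and $H_{0,0}$ is the restriction of $H_{\max}$ to the functions with $g(b)=g(a)=g^{[1]}(a)=0$.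 For every $z\in\rho(H_{\theta_a,0})\cap\rho(H_{0,0})$ the number $d_{\theta_a,0}(z)=\cot(\theta_a)+u_2^{[1]}(z,a)$ is nonzero and $$(H_{\theta_a,0}-z)^{-1}=(H_{0,0}-z)^{-1}-d_{\theta_a,0}(z)^{-1}(u_2(\overline z,\cdot),\cdot)\,u_2(z,\cdot).$$ (iii) If $\theta_b\neq0$, then the maximal common part of $H_{0,\theta_b}$ and $H_{0,0}$ is the restriction of $H_{\max}$ to the functions with $g(b)=g(a)=g^{[1]}(b)=0$. For every $z\in\rho(H_{0,\theta_b})\cap\rho(H_{0,0})$ the number $d_{0,\theta_b}(z)=\cot(\theta_b)-u_1^{[1]}(z,b)$ is nonzero and $$(H_{0,\theta_b}-z)^{-1}=(H_{0,0}-z)^{-1}-d_{0,\theta_b}(z)^{-1}(u_1(\overline z,\cdot),\cdot)\,u_1(z,\cdot).$$ -/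

import Mathlib

open MeasureTheory Set Filter
open scoped ComplexConjugate

noncomputable section

/-- Coefficients of a regular three-coefficient Sturm--Liouville expression
`τ = r⁻¹ (-(d/dx) p (d/dx) + q)` on a compact interval `[a, b]`. -/
structure RegularSL where
  /-- left endpoint -/
  a : ℝ
  /-- right endpoint -/
  b : ℝ
  p : ℝ → ℝ
  q : ℝ → ℝ
  r : ℝ → ℝ
  a_lt_b : a < b
  r_pos : ∀ᵐ x ∂(volume.restrict (Ioo a b)), 0 < r x
  r_int : IntegrableOn r (Ioo a b)
  p_pos : ∀ᵐ x ∂(volume.restrict (Ioo a b)), 0 < p x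
  inv_p_int : IntegrableOn (fun x => 1 / p x) (Ioo a b)
  q_int : IntegrableOn q (Ioo a b)

namespace RegularSL

variable (S : RegularSL)

/-- The measure `r dx` on `(a, b)`. -/
def weight : Measure ℝ :=
  (volume.restrict (Ioo S.a S.b)).withDensity (fun x => ENNReal.ofReal (S.r x))

/-- The Hilbert space `L²((a,b); r dx)` of complex-valued functions. -/
abbrev L2 : Type := Lp ℂ 2 S.weight

/-- `g` is absolutely continuous on `[a,b]` and its first quasi-derivative `g^{[1]} = p g'` (which is
defined almost everywhere) has the absolutely continuous representative `g₁` on `[a,b]`. -/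
structure IsQuasiPair (g g₁ : ℝ → ℂ) : Prop where
  ac : AbsolutelyContinuousOnInterval g S.a S.b
  ac₁ : AbsolutelyContinuousOnInterval g₁ S.a S.b
  eq : ∀ᵐ x ∂(volume.restrict (Ioo S.a S.b)), g₁ x = (S.p x : ℂ) * deriv g x

/-- `τ g = r⁻¹ (-(g^{[1]})' + q g)`, as a function of `g` and of its quasi-derivative `g₁`. -/
def tau (g g₁ : ℝ → ℂ) (x : ℝ) : ℂ :=
  (1 / (S.r x : ℂ)) * (-(deriv g₁ x) + (S.q x : ℂ) * g x)

/-! ### Algebra of quasi-derivative pairs -/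

variable {S}

theorem ae_differentiableAt_of_ac {g : ℝ → ℂ} (hg : AbsolutelyContinuousOnInterval g S.a S.b) :
    ∀ᵐ x ∂(volume.restrict (Ioo S.a S.b)), DifferentiableAt ℝ g x := by
  have h := hg.boundedVariationOn.ae_differentiableAt_of_mem_uIcc
  rw [ae_restrict_iff' measurableSet_Ioo]
  filter_upwards [h] with x hx hxI
  exact hx (by rw [uIcc_of_le S.a_lt_b.le]; exact Ioo_subset_Icc_self hxI)

theorem IsQuasiPair.zero : S.IsQuasiPair 0 0 where
  ac := by simpa [AbsolutelyContinuousOnInterval] using tendsto_const_nhds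
  ac₁ := by simpa [AbsolutelyContinuousOnInterval] using tendsto_const_nhds
  eq := by
    refine ae_of_all _ fun x => ?_
    have h0 : deriv (0 : ℝ → ℂ) x = 0 := deriv_const x 0
    rw [h0]; simp

theorem tau_zero (x : ℝ) : S.tau 0 0 x = 0 := by
  have h0 : deriv (0 : ℝ → ℂ) x = 0 := deriv_const x 0
  simp [tau, h0]

theorem IsQuasiPair.add {g g₁ k k₁ : ℝ → ℂ} (h : S.IsQuasiPair g g₁) (h' : S.IsQuasiPair k k₁) :
    S.IsQuasiPair (g + k) (g₁ + k₁) where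
  ac := h.ac.add h'.ac
  ac₁ := h.ac₁.add h'.ac₁
  eq := by
    filter_upwards [h.eq, h'.eq, ae_differentiableAt_of_ac h.ac, ae_differentiableAt_of_ac h'.ac]
      with x h1 h2 h3 h4
    rw [deriv_add h3 h4, Pi.add_apply, h1, h2]; ring

theorem IsQuasiPair.tau_add {g g₁ k k₁ : ℝ → ℂ} (h : S.IsQuasiPair g g₁)
    (h' : S.IsQuasiPair k k₁) : ∀ᵐ x ∂(volume.restrict (Ioo S.a S.b)),
    S.tau (g + k) (g₁ + k₁) x = S.tau g g₁ x + S.tau k k₁ x := by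
  filter_upwards [ae_differentiableAt_of_ac h.ac₁, ae_differentiableAt_of_ac h'.ac₁] with x h3 h4
  rw [tau, deriv_add h3 h4, Pi.add_apply, tau, tau]; ring

theorem IsQuasiPair.smul {g g₁ : ℝ → ℂ} (c : ℂ) (h : S.IsQuasiPair g g₁) :
    S.IsQuasiPair (c • g) (c • g₁) where
  ac := h.ac.const_smul c
  ac₁ := h.ac₁.const_smul c
  eq := by
    filter_upwards [h.eq, ae_differentiableAt_of_ac h.ac] with x h1 h3
    rw [deriv_const_smul c h3, Pi.smul_apply, h1, smul_eq_mul, smul_eq_mul]; ring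

theorem IsQuasiPair.tau_smul {g g₁ : ℝ → ℂ} (c : ℂ) (h : S.IsQuasiPair g g₁) :
    ∀ᵐ x ∂(volume.restrict (Ioo S.a S.b)), S.tau (c • g) (c • g₁) x = c * S.tau g g₁ x := by
  filter_upwards [ae_differentiableAt_of_ac h.ac₁] with x h3
  rw [tau, deriv_const_smul c h3, Pi.smul_apply, tau, smul_eq_mul, smul_eq_mul]; ring

variable (S)

theorem weight_absolutelyContinuous : S.weight ≪ volume.restrict (Ioo S.a S.b) :=
  withDensity_absolutelyContinuous _ _

theorem absolutelyContinuous_weight : volume.restrict (Ioo S.a S.b) ≪ S.weight := by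
  refine withDensity_absolutelyContinuous' S.r_int.aemeasurable.ennreal_ofReal ?_
  filter_upwards [S.r_pos] with x hx
  simpa using hx

/-! ### The maximal operator and its restrictions -/

/-- The graph of the maximal operator: all `(f, τ f)` in `L² × L²` such that `f` and `f^{[1]}` are
absolutely continuous on `[a,b]`. -/
def maxGraph : Submodule ℂ (S.L2 × S.L2) where
  carrier := {F | ∃ g g₁ : ℝ → ℂ, S.IsQuasiPair g g₁ ∧
    (F.1 : ℝ → ℂ) =ᵐ[S.weight] g ∧ (F.2 : ℝ → ℂ) =ᵐ[S.weight] S.tau g g₁}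
  zero_mem' := by
    refine ⟨0, 0, IsQuasiPair.zero, Lp.coeFn_zero _ _ _, ?_⟩
    filter_upwards [Lp.coeFn_zero ℂ 2 S.weight] with x hx
    rw [tau_zero]; simpa using hx
  add_mem' := by
    rintro F F' ⟨g, g₁, h, h1, h2⟩ ⟨k, k₁, h', h1', h2'⟩
    refine ⟨g + k, g₁ + k₁, h.add h', (Lp.coeFn_add _ _).trans (h1.add h1'), ?_⟩
    filter_upwards [Lp.coeFn_add F.2 F'.2, h2, h2',
      S.weight_absolutelyContinuous.ae_le (h.tau_add h')] with x a1 a2 a3 a4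
    rw [a4, ← a2, ← a3]; exact a1
  smul_mem' := by
    rintro c F ⟨g, g₁, h, h1, h2⟩
    refine ⟨c • g, c • g₁, h.smul c, (Lp.coeFn_smul _ _).trans (h1.const_smul c), ?_⟩
    filter_upwards [Lp.coeFn_smul c F.2, h2,
      S.weight_absolutelyContinuous.ae_le (h.tau_smul c)] with x a1 a2 a4
    rw [a4, ← a2]; exact a1

/-- The maximal operator `H_max`. -/
def maxOp : S.L2 →ₗ.[ℂ] S.L2 := S.maxGraph.toLinearPMap

/-- Boundary data `((g(a), g^{[1]}(a)), (g(b), g^{[1]}(b)))`. -/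
abbrev BData : Type := (ℂ × ℂ) × (ℂ × ℂ)

/-- The `f ∈ L²` such that `f` and `f^{[1]}` are absolutely continuous on `[a,b]`, with boundary data
`((f(a), f^{[1]}(a)), (f(b), f^{[1]}(b)))` in the subspace `K`. -/
def bdrySubmodule (K : Submodule ℂ BData) : Submodule ℂ S.L2 where
  carrier := {f | ∃ g g₁ : ℝ → ℂ, S.IsQuasiPair g g₁ ∧ (f : ℝ → ℂ) =ᵐ[S.weight] g ∧
    (((g S.a, g₁ S.a), (g S.b, g₁ S.b)) : BData) ∈ K}
  zero_mem' := ⟨0, 0, IsQuasiPair.zero, Lp.coeFn_zero _ _ _, K.zero_mem⟩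
  add_mem' := by
    rintro F F' ⟨g, g₁, h, h1, h2⟩ ⟨k, k₁, h', h1', h2'⟩
    exact ⟨g + k, g₁ + k₁, h.add h', (Lp.coeFn_add _ _).trans (h1.add h1'), K.add_mem h2 h2'⟩
  smul_mem' := by
    rintro c F ⟨g, g₁, h, h1, h2⟩
    exact ⟨c • g, c • g₁, h.smul c, (Lp.coeFn_smul _ _).trans (h1.const_smul c), K.smul_mem c h2⟩

/-- The restriction of `H_max` to the functions with boundary data in `K`. -/
def restrictOp (K : Submodule ℂ BData) : S.L2 →ₗ.[ℂ] S.L2 := S.maxOp.domRestrict (S.bdrySubmodule K)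

/-- The minimal operator: `g(a) = g^{[1]}(a) = g(b) = g^{[1]}(b) = 0`. -/
def minOp : S.L2 →ₗ.[ℂ] S.L2 := S.restrictOp ⊥

/-- Separated boundary conditions `cos θa g(a) + sin θa g^{[1]}(a) = 0` and
`cos θb g(b) - sin θb g^{[1]}(b) = 0`. -/
def sepBC (θa θb : ℝ) : Submodule ℂ BData where
  carrier := {v | (Real.cos θa : ℂ) * v.1.1 + (Real.sin θa : ℂ) * v.1.2 = 0 ∧
    (Real.cos θb : ℂ) * v.2.1 - (Real.sin θb : ℂ) * v.2.2 = 0}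
  zero_mem' := by simp
  add_mem' := by
    rintro v w ⟨h1, h2⟩ ⟨h3, h4⟩
    simp only [mem_ofPred_eq, Prod.fst_add, Prod.snd_add]
    exact ⟨by linear_combination h1 + h3, by linear_combination h2 + h4⟩
  smul_mem' := by
    rintro c v ⟨h1, h2⟩
    simp only [mem_ofPred_eq, Prod.smul_fst, Prod.smul_snd, smul_eq_mul]
    exact ⟨by linear_combination c * h1, by linear_combination c * h2⟩

/-- The operator `H_{θa,θb}`; in particular `sepOp 0 0` is the Dirichlet operator `H_{0,0}`. -/
def sepOp (θa θb : ℝ) : S.L2 →ₗ.[ℂ] S.L2 := S.restrictOp (sepBC θa θb)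

/-- The conditions `g(b) = g(a) = g^{[1]}(a) = 0`. -/
def tildeBC : Submodule ℂ BData where
  carrier := {v | v.2.1 = 0 ∧ v.1.1 = 0 ∧ v.1.2 = 0}
  zero_mem' := by simp
  add_mem' := by
    rintro v w ⟨h1, h2, h3⟩ ⟨h4, h5, h6⟩
    simp [h1, h2, h3, h4, h5, h6]
  smul_mem' := by
    rintro c v ⟨h1, h2, h3⟩
    simp [h1, h2, h3]

/-- The restriction of `H_max` by `g(b) = g(a) = g^{[1]}(a) = 0`. -/
def tildeMinOp : S.L2 →ₗ.[ℂ] S.L2 := S.restrictOp tildeBC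

/-- The conditions `g(b) = g(a) = g^{[1]}(b) = 0`. -/
def hatBC : Submodule ℂ BData where
  carrier := {v | v.2.1 = 0 ∧ v.1.1 = 0 ∧ v.2.2 = 0}
  zero_mem' := by simp
  add_mem' := by
    rintro v w ⟨h1, h2, h3⟩ ⟨h4, h5, h6⟩
    simp [h1, h2, h3, h4, h5, h6]
  smul_mem' := by
    rintro c v ⟨h1, h2, h3⟩
    simp [h1, h2, h3]

/-- The restriction of `H_max` by `g(b) = g(a) = g^{[1]}(b) = 0`. -/
def hatMinOp : S.L2 →ₗ.[ℂ] S.L2 := S.restrictOp hatBC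

/-! `τ` is well defined on `L²`-classes, so `maxOp` really has the graph `maxGraph`. -/

variable {S} in
theorem eqOn_zero_of_ae {g : ℝ → ℂ} (hg : AbsolutelyContinuousOnInterval g S.a S.b)
    (h0 : ∀ᵐ x ∂(volume.restrict (Ioo S.a S.b)), g x = 0) : EqOn g 0 (Icc S.a S.b) := by
  have hc := hg.continuousOn
  rw [uIcc_of_le S.a_lt_b.le] at hc
  refine Measure.eqOn_Icc_of_ae_eq volume S.a_lt_b.ne ?_ hc continuousOn_const
  rw [← restrict_Ioo_eq_restrict_Icc]
  exact h0

variable {S} in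
theorem IsQuasiPair.eqOn_zero {g g₁ : ℝ → ℂ} (h : S.IsQuasiPair g g₁)
    (h0 : ∀ᵐ x ∂(volume.restrict (Ioo S.a S.b)), g x = 0) :
    EqOn g 0 (Icc S.a S.b) ∧ EqOn g₁ 0 (Icc S.a S.b) := by
  have hz := eqOn_zero_of_ae h.ac h0
  refine ⟨hz, eqOn_zero_of_ae h.ac₁ ?_⟩
  filter_upwards [h.eq, ae_restrict_mem measurableSet_Ioo] with x hx hxI
  have he : g =ᶠ[nhds x] fun _ => (0 : ℂ) := by
    filter_upwards [isOpen_Ioo.mem_nhds hxI] with y hy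
    exact hz (Ioo_subset_Icc_self hy)
  rw [hx, he.deriv_eq, deriv_const, mul_zero]

theorem maxOp_graph : S.maxOp.graph = S.maxGraph := by
  refine Submodule.toLinearPMap_graph_eq _ ?_
  rintro ⟨f, h⟩ ⟨g, g₁, hp, h1, h2⟩ hf
  simp only at hf h1 h2 ⊢
  subst hf
  have h0 : ∀ᵐ x ∂(volume.restrict (Ioo S.a S.b)), g x = 0 := by
    refine S.absolutelyContinuous_weight.ae_le ?_
    filter_upwards [h1, Lp.coeFn_zero ℂ 2 S.weight] with x a1 a2
    rw [← a1, a2]; rfl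
  obtain ⟨hz, hz₁⟩ := hp.eqOn_zero h0
  refine (Lp.eq_zero_iff_ae_eq_zero).2 (h2.trans ?_)
  filter_upwards [S.weight_absolutelyContinuous.ae_le (ae_restrict_mem measurableSet_Ioo)]
    with x hxI
  have he : g₁ =ᶠ[nhds x] fun _ => (0 : ℂ) := by
    filter_upwards [isOpen_Ioo.mem_nhds hxI] with y hy
    exact hz₁ (Ioo_subset_Icc_self hy)
  rw [tau, he.deriv_eq, deriv_const, hz (Ioo_subset_Icc_self hxI)]
  simp

end RegularSL

/-! ### Resolvents and common parts of unbounded operators -/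

section Operators

variable {E : Type*} [NormedAddCommGroup E] [InnerProductSpace ℂ E]

/-- `R` is a bounded, everywhere defined two-sided inverse of `T - z I`. -/
def IsResolventAt (T : E →ₗ.[ℂ] E) (z : ℂ) (R : E →L[ℂ] E) : Prop :=
  (∀ f : E, ∃ h : R f ∈ T.domain, T ⟨R f, h⟩ - z • R f = f) ∧
    ∀ u : T.domain, R (T u - z • (u : E)) = u

/-- The resolvent set `ρ(T)`. -/
def resolvSet (T : E →ₗ.[ℂ] E) : Set ℂ := {z | ∃ R : E →L[ℂ] E, IsResolventAt T z R}

/-- The resolvent `(T - z I)⁻¹` for `z ∈ ρ(T)` (an arbitrary operator for other `z`). -/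
def resolv (T : E →ₗ.[ℂ] E) (z : ℂ) : E →L[ℂ] E := Classical.epsilon (IsResolventAt T z)

/-- `ker (T - z I)`. -/
def kerSub (T : E →ₗ.[ℂ] E) (z : ℂ) : Submodule ℂ E :=
  T.eqLocus ((z • (LinearMap.id : E →ₗ[ℂ] E)).toPMap ⊤)

/-- The maximal common part of `A₁` and `A₂`: the operator `f ↦ A₁ f` with domain
`{f ∈ dom A₁ ∩ dom A₂ | A₁ f = A₂ f}`, which is the infimum for the extension order. -/
def maxCommonPart (A₁ A₂ : E →ₗ.[ℂ] E) : E →ₗ.[ℂ] E := A₁ ⊓ A₂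

end Operators

namespace RegularSL

variable (S : RegularSL)

/-! ### The distinguished basis of `ker (H_max - z I)` -/

/-- `u` (with quasi-derivative `u₁`) solves `τ u = z u` on `(a,b)`. -/
def IsSolution (z : ℂ) (u u₁ : ℝ → ℂ) : Prop :=
  S.IsQuasiPair u u₁ ∧ ∀ᵐ x ∂(volume.restrict (Ioo S.a S.b)), S.tau u u₁ x = z * u x

/-- The solution of `τ u = z u` with `u(a) = α`, `u(b) = β`, together with its quasi-derivative;
for `z ∈ ρ(H_{0,0})` it exists and is unique on `[a,b]` (other `z` are not used). -/
def bvpSolution (z α β : ℂ) : (ℝ → ℂ) × (ℝ → ℂ) :=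
  Classical.epsilon fun w : (ℝ → ℂ) × (ℝ → ℂ) =>
    S.IsSolution z w.1 w.2 ∧ w.1 S.a = α ∧ w.1 S.b = β

/-- `u 0 z = u_1(z,·)` with boundary values `0` at `a` and `1` at `b`;
`u 1 z = u_2(z,·)` with boundary values `1` at `a` and `0` at `b`. -/
def u (j : Fin 2) (z : ℂ) : ℝ → ℂ := (S.bvpSolution z (![0, 1] j) (![1, 0] j)).1

/-- The quasi-derivatives `u_1^{[1]}(z,·)` (index `0`) and `u_2^{[1]}(z,·)` (index `1`). -/
def uQuasi (j : Fin 2) (z : ℂ) : ℝ → ℂ := (S.bvpSolution z (![0, 1] j) (![1, 0] j)).2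

open Classical in
/-- The class of a square-integrable function in `L²((a,b); r dx)`. -/
def toL2 (g : ℝ → ℂ) : S.L2 := if h : MemLp g 2 S.weight then h.toLp g else 0

/-- `u_1(z,·)` (index `0`) and `u_2(z,·)` (index `1`) as elements of `L²((a,b); r dx)`. -/
def uL2 (j : Fin 2) (z : ℂ) : S.L2 := S.toL2 (S.u j z)

/-- The matrix `D_{θa,θb}(z)`. -/
def D (θa θb : ℝ) (z : ℂ) : Matrix (Fin 2) (Fin 2) ℂ :=
  !![(Real.cot θb : ℂ) - S.uQuasi 0 z S.b, -S.uQuasi 1 z S.b;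
     S.uQuasi 0 z S.a, (Real.cot θa : ℂ) + S.uQuasi 1 z S.a]

/-- The scalar `d_{θa,0}(z)`. -/
def dLeft (θa : ℝ) (z : ℂ) : ℂ := (Real.cot θa : ℂ) + S.uQuasi 1 z S.a

/-- The scalar `d_{0,θb}(z)`. -/
def dRight (θb : ℝ) (z : ℂ) : ℂ := (Real.cot θb : ℂ) - S.uQuasi 0 z S.b

end RegularSL

end

noncomputable section

/-! ### Absolutely continuous functions -/

namespace AbsolutelyContinuousOnInterval

/-! Fix `f` and let `G` and `V` be the images of `f` under the resolvents at `z` of the operator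
with boundary conditions `K` and of the Dirichlet operator. The difference `G - V` solves `τ y = z
y`, and `V` vanishes at both endpoints, so `G = V + G(b) u_1 + G(a) u_2` (`exists_resolv_eq`). Only
the two numbers `c = (G(b), G(a))` remain to be found, and the boundary conditions on `G` determine
them. These involve `V^{[1]}` at the endpoints, which Green's formula against `u_j(z,·)` evaluates
as `V^{[1]}(a) = (u_2(z̄,·), f)` and `V^{[1]}(b) = -(u_1(z̄,·), f)`
(`DirichletInjective.inner_uL2`). After division by the sines the conditions read `D c =
-((u_1(z̄,·), f), (u_2(z̄,·), f))`. A vector in the kernel of `D` would give an eigenfunction at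
`z`, so `D` is invertible (`eq_zero_of_combinationData_mem`). A Dirichlet condition at one end kills
one coefficient and leaves a scalar equation.

The basis `u_1, u_2` comes from initial value problems with merely integrable coefficients, solved
as Volterra equations (`exists_continuous_volterra`). The common parts reduce to intersecting spaces
of boundary data, because all operators restrict `H_max` (`restrictOp_inf`). -/

theorem of_dist_le {X Y : Type*} [PseudoMetricSpace X] [PseudoMetricSpace Y] {f : ℝ → X}
    {g : ℝ → Y} {a b C : ℝ} (hf : AbsolutelyContinuousOnInterval f a b)
    (h : ∀ x ∈ uIcc a b, ∀ y ∈ uIcc a b, dist (g x) (g y) ≤ C * dist (f x) (f y)) :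
    AbsolutelyContinuousOnInterval g a b := by
  have hC : Tendsto (fun E : ℕ × (ℕ → ℝ × ℝ) =>
      C * ∑ i ∈ Finset.range E.1, dist (f (E.2 i).1) (f (E.2 i).2))
      (totalLengthFilter ⊓ 𝓟 (disjWithin a b)) (nhds 0) := by
    unfold AbsolutelyContinuousOnInterval at hf
    simpa only [mul_zero] using Filter.Tendsto.const_mul C hf
  refine squeeze_zero' (Eventually.of_forall fun E => Finset.sum_nonneg fun i _ => dist_nonneg)
    ?_ hC
  have hm : ∀ᶠ E in totalLengthFilter ⊓ 𝓟 (disjWithin a b), E ∈ disjWithin a b :=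
    mem_inf_of_right (mem_principal_self _)
  filter_upwards [hm] with E hE
  rw [Finset.mul_sum]
  exact Finset.sum_le_sum fun i hi => h _ (hE.1 i hi).1 _ (hE.1 i hi).2

/-- The values of `f` stay in a compact interval, on which a `C¹` function is Lipschitz. -/
theorem comp_contDiff {f : ℝ → ℝ} {φ : ℝ → ℝ} {a b : ℝ}
    (hf : AbsolutelyContinuousOnInterval f a b) (hφ : ContDiff ℝ 1 φ) :
    AbsolutelyContinuousOnInterval (fun x => φ (f x)) a b := by
  obtain ⟨C, hC⟩ := hf.exists_bound
  obtain ⟨K, hK⟩ := (hφ.contDiffOn (s := Icc (-C) C)).exists_lipschitzOnWith (by decide)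
    (convex_Icc _ _) isCompact_Icc
  have hm : ∀ x ∈ uIcc a b, f x ∈ Icc (-C) C := fun x hx => abs_le.1 (hC x hx)
  exact hf.of_dist_le (C := K) fun x hx y hy => hK.dist_le_mul _ (hm x hx) _ (hm y hy)

variable {F : Type*} [NormedAddCommGroup F] [NormedSpace ℝ F]

/-- Increments of the primitive are dominated by those of the real primitive of `‖h‖`. -/
theorem intervalIntegral_of_intervalIntegrable {h : ℝ → F} {a b : ℝ}
    (hh : IntervalIntegrable h volume a b) :
    AbsolutelyContinuousOnInterval (fun x => ∫ t in a..x, h t) a b := by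
  have hn := hh.norm.absolutelyContinuousOnInterval_intervalIntegral (c := a) left_mem_uIcc
  refine hn.of_dist_le (C := 1) fun x hx y hy => ?_
  have hi : ∀ u ∈ uIcc a b, IntervalIntegrable h volume a u := fun u hu =>
    hh.mono_set (uIcc_subset_uIcc left_mem_uIcc hu)
  rw [one_mul, dist_comm, dist_comm (∫ t in a..x, ‖h t‖), dist_eq_norm, Real.dist_eq,
    intervalIntegral.integral_interval_sub_left (hi y hy) (hi x hx),
    intervalIntegral.integral_interval_sub_left (hi y hy).norm (hi x hx).norm]
  exact intervalIntegral.norm_integral_le_abs_integral_norm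

/-- The fundamental theorem of calculus for absolutely continuous functions with values in a Banach
space that are differentiable almost everywhere with integrable derivative. -/
theorem eq_add_integral [CompleteSpace F] {g h : ℝ → F} {a b : ℝ}
    (hg : AbsolutelyContinuousOnInterval g a b) (hh : IntervalIntegrable h volume a b)
    (hd : ∀ᵐ x, x ∈ uIcc a b → HasDerivAt g (h x) x) {x : ℝ} (hx : x ∈ uIcc a b) :
    g x = g a + ∫ t in a..x, h t := by
  -- Subtracting the primitive leaves an absolutely continuous function with zero derivative almost
  -- everywhere, hence a constant.
  have hk : AbsolutelyContinuousOnInterval (fun x => g x - ∫ t in a..x, h t) a b :=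
    hg.sub (intervalIntegral_of_intervalIntegrable hh)
  obtain ⟨C, hC⟩ := hk.const_of_ae_hasDerivAt_zero (by
    filter_upwards [hd, hh.ae_hasDerivAt_integral] with x h1 h2 h3
    have h4 := (h1 h3).sub (h2 h3 a left_mem_uIcc)
    rw [sub_self] at h4
    exact h4)
  have h1 := hC x hx
  have h2 := hC a left_mem_uIcc
  simp only [intervalIntegral.integral_same, sub_zero] at h2
  rw [h2, ← h1]; abel

end AbsolutelyContinuousOnInterval

theorem ae_mem_uIcc_of_ae_restrict_Ioo {a b : ℝ} (hab : a ≤ b) {P : ℝ → Prop}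
    (h : ∀ᵐ x ∂(volume.restrict (Ioo a b)), P x) : ∀ᵐ x, x ∈ uIcc a b → P x := by
  rw [restrict_Ioo_eq_restrict_Icc, ae_restrict_iff' measurableSet_Icc] at h
  rwa [uIcc_of_le hab]

theorem ae_restrict_Ioo_of_ae_mem_uIcc {a b : ℝ} (hab : a ≤ b) {P : ℝ → Prop}
    (h : ∀ᵐ x, x ∈ uIcc a b → P x) : ∀ᵐ x ∂(volume.restrict (Ioo a b)), P x := by
  rw [restrict_Ioo_eq_restrict_Icc, ae_restrict_iff' measurableSet_Icc]
  rwa [uIcc_of_le hab] at h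

/-! ### Linear Volterra equations with integrable coefficients -/

/-- With `K` the primitive of `k`, the derivative of `exp (2K)` is `2 k exp (2K)` almost everywhere.
The factor 2 is what yields the contraction constant 1/2 for the Volterra operator. -/
theorem intervalIntegral_mul_exp_primitive {a b : ℝ} {k : ℝ → ℝ}
    (hk : IntervalIntegrable k volume a b) {x : ℝ} (hx : x ∈ uIcc a b) :
    ∫ t in a..x, k t * Real.exp (2 * ∫ s in a..t, k s) =
      (Real.exp (2 * ∫ s in a..x, k s) - 1) / 2 := by
  have hK := AbsolutelyContinuousOnInterval.intervalIntegral_of_intervalIntegrable hk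
  have hE := hK.comp_contDiff (φ := fun s => Real.exp (2 * s)) (by fun_prop)
  have hi : IntervalIntegrable (fun t => k t * Real.exp (2 * ∫ s in a..t, k s)) volume a b :=
    hk.mul_continuousOn hE.continuousOn
  have h := hE.eq_add_integral (hi.const_mul 2) (by
    filter_upwards [hk.ae_hasDerivAt_integral] with x h1 h2
    convert! ((h1 h2 a left_mem_uIcc).const_mul 2).exp using 1
    ring) hx
  simp only [intervalIntegral.integral_same, mul_zero, Real.exp_zero,
    intervalIntegral.integral_const_mul] at h
  rw [h]; ring

section Volterra

variable {E : Type*} [NormedAddCommGroup E] [NormedSpace ℝ E]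

/-- A Volterra equation `y(x) = y₀ + ∫ₐˣ F(t, y(t)) dt` whose right-hand side is Lipschitz with an
integrable Lipschitz function has a continuous solution. -/
theorem exists_continuous_volterra [CompleteSpace E] {a b : ℝ} (hab : a ≤ b) {k : ℝ → ℝ}
    (hk : IntervalIntegrable k volume a b) (hk0 : ∀ t, 0 ≤ k t) {F : ℝ → E → E}
    (hF : ∀ y : ℝ → E, Continuous y → IntervalIntegrable (fun t => F t (y t)) volume a b)
    (hL : ∀ t u v, ‖F t u - F t v‖ ≤ k t * ‖u - v‖) (y₀ : E) :
    ∃ y : ℝ → E, Continuous y ∧ ∀ x ∈ Icc a b, y x = y₀ + ∫ t in a..x, F t (y t) := by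
  set K : ℝ → ℝ := fun x => ∫ t in a..x, k t with hKdef
  have hu : uIcc a b = Icc a b := uIcc_of_le hab
  have hKc : ContinuousOn K (Icc a b) := by
    rw [← hu]
    exact (AbsolutelyContinuousOnInterval.intervalIntegral_of_intervalIntegrable hk).continuousOn
  -- Extended by constants beyond `[a, b]`, because `hF` asks for functions continuous on the whole
  -- line.
  set K' : ℝ → ℝ := IccExtend hab ((Icc a b).domRestrict K) with hK'def
  have hK'c : Continuous K' := hKc.domRestrict.Icc_extend'
  have hK' : ∀ x ∈ Icc a b, K' x = K x := fun x hx => by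
    rw [hK'def, IccExtend_of_mem hab _ hx]; rfl
  have hsub : ∀ x ∈ Icc a b, uIcc a x ⊆ uIcc a b := fun x hx =>
    uIcc_subset_uIcc left_mem_uIcc (hu ▸ hx)
  -- Writing `y = exp (2K) z` amounts to using a weighted sup norm for `y`. In it the integral
  -- operator contracts on all of `[a, b]` at once, however large `∫ k` is.
  let Y : C(Icc a b, E) → ℝ → E := fun z t => Real.exp (2 * K' t) • IccExtend hab z t
  have hYc : ∀ z, Continuous (Y z) := fun z => by
    have : Continuous (IccExtend hab z) := z.continuous.Icc_extend'
    fun_prop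
  have hT : ∀ z, Continuous fun x : Icc a b =>
      Real.exp (-(2 * K' x)) • (y₀ + ∫ t in a..(x : ℝ), F t (Y z t)) := fun z => by
    have h1 : ContinuousOn (fun x => ∫ t in a..x, F t (Y z t)) (Icc a b) := by
      rw [← hu]
      exact (AbsolutelyContinuousOnInterval.intervalIntegral_of_intervalIntegrable
        (hF _ (hYc z))).continuousOn
    have h2 : Continuous fun x : Icc a b => ∫ t in a..(x : ℝ), F t (Y z t) := h1.domRestrict
    fun_prop
  let T : C(Icc a b, E) → C(Icc a b, E) := fun z => ⟨_, hT z⟩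
  have hTc : ContractingWith (1 / 2) T := by
    refine ⟨by norm_num, LipschitzWith.of_dist_le_mul fun z w => ?_⟩
    rw [ContinuousMap.dist_le (by positivity)]
    rintro ⟨x, hx⟩
    have e1 : T z ⟨x, hx⟩ - T w ⟨x, hx⟩ =
        Real.exp (-(2 * K x)) • ∫ t in a..x, (F t (Y z t) - F t (Y w t)) := by
      rw [intervalIntegral.integral_sub ((hF _ (hYc z)).mono_set (hsub x hx))
        ((hF _ (hYc w)).mono_set (hsub x hx))]
      simp only [T, ContinuousMap.coe_mk, hK' x hx]
      rw [← smul_sub]; congr 1; abel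
    have e2 : ‖∫ t in a..x, (F t (Y z t) - F t (Y w t))‖ ≤
        ∫ t in a..x, k t * Real.exp (2 * K t) * dist z w := by
      refine intervalIntegral.norm_integral_le_of_norm_le hx.1 (ae_of_all _ fun t ht => ?_) ?_
      · have htI : t ∈ Icc a b := ⟨ht.1.le, ht.2.trans hx.2⟩
        refine (hL _ _ _).trans ?_
        rw [mul_assoc]
        refine mul_le_mul_of_nonneg_left ?_ (hk0 t)
        simp only [Y, hK' t htI]
        rw [← smul_sub, norm_smul, Real.norm_eq_abs, Real.abs_exp]
        refine mul_le_mul_of_nonneg_left ?_ (Real.exp_pos _).le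
        rw [IccExtend_of_mem hab _ htI, IccExtend_of_mem hab _ htI, ← dist_eq_norm]
        exact ContinuousMap.dist_apply_le_dist _
      · refine (IntervalIntegrable.mul_continuousOn (hk.mono_set (hsub x hx)) ?_).mul_const _
        refine ContinuousOn.mono ?_ (hu ▸ hsub x hx)
        fun_prop
    rw [intervalIntegral.integral_mul_const,
      intervalIntegral_mul_exp_primitive hk (hu ▸ hx)] at e2
    rw [dist_eq_norm, e1, norm_smul, Real.norm_eq_abs, Real.abs_exp]
    calc Real.exp (-(2 * K x)) * _ ≤ Real.exp (-(2 * K x)) *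
          ((Real.exp (2 * K x) - 1) / 2 * dist z w) :=
          mul_le_mul_of_nonneg_left e2 (Real.exp_pos _).le
      _ = (1 - Real.exp (-(2 * K x))) / 2 * dist z w := by
          have : Real.exp (-(2 * K x)) * Real.exp (2 * K x) = 1 := by
            rw [← Real.exp_add]; simp
          linear_combination (dist z w / 2) * this
      _ ≤ _ := by
          refine mul_le_mul_of_nonneg_right ?_ dist_nonneg
          have := Real.exp_pos (-(2 * K x))
          push_cast
          linarith
  have hz := hTc.fixedPoint_isFixedPt
  set z := ContractingWith.fixedPoint T hTc
  refine ⟨Y z, hYc z, fun x hx => ?_⟩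
  have h1 : z ⟨x, hx⟩ = Real.exp (-(2 * K' x)) • (y₀ + ∫ t in a..x, F t (Y z t)) := by
    conv_lhs => rw [← hz.eq]
    rfl
  simp only [Y]
  rw [IccExtend_of_mem hab _ hx, h1, smul_smul, ← Real.exp_add]
  simp [Y]

end Volterra

/-- A first order linear `2 × 2` off-diagonal system with integrable coefficients has a solution
with prescribed initial values. -/
theorem exists_offDiagonal_system {a b : ℝ} (hab : a ≤ b) {c₁ c₂ : ℝ → ℂ}
    (h₁ : IntervalIntegrable c₁ volume a b) (h₂ : IntervalIntegrable c₂ volume a b) (α β : ℂ) :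
    ∃ g g₁ : ℝ → ℂ, AbsolutelyContinuousOnInterval g a b ∧
      AbsolutelyContinuousOnInterval g₁ a b ∧ g a = α ∧ g₁ a = β ∧
      (∀ᵐ x, x ∈ uIcc a b → HasDerivAt g (c₁ x * g₁ x) x) ∧
      (∀ᵐ x, x ∈ uIcc a b → HasDerivAt g₁ (c₂ x * g x) x) := by
  have hi : ∀ {c : ℝ → ℂ} {y : ℝ → ℂ}, IntervalIntegrable c volume a b → Continuous y →
      IntervalIntegrable (fun t => c t * y t) volume a b := fun hc hy =>
    hc.mul_continuousOn hy.continuousOn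
  obtain ⟨y, hy, hyx⟩ := exists_continuous_volterra hab (E := ℂ × ℂ)
    (k := fun t => ‖c₁ t‖ + ‖c₂ t‖) (h₁.norm.add h₂.norm) (fun t => by positivity)
    (F := fun t u => (c₁ t * u.2, c₂ t * u.1))
    (fun y hy => by
      rw [intervalIntegrable_iff]
      exact ((intervalIntegrable_iff.1 (hi h₁ hy.snd)).prodMk
        (intervalIntegrable_iff.1 (hi h₂ hy.fst))))
    (fun t u v => by
      have n1 := norm_fst_le (u - v)
      have n2 := norm_snd_le (u - v)
      have p1 := norm_nonneg (c₁ t)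
      have p2 := norm_nonneg (c₂ t)
      have p3 := norm_nonneg (u - v)
      rw [Prod.norm_def]
      simp only [Prod.fst_sub, Prod.snd_sub, ← mul_sub, norm_mul] at n1 n2 ⊢
      refine max_le ?_ ?_
      · nlinarith
      · nlinarith) (α, β)
  have hi1 := hi h₁ hy.snd
  have hi2 := hi h₂ hy.fst
  have hx : ∀ x ∈ Icc a b, (y x).1 = α + ∫ t in a..x, c₁ t * (y t).2 ∧
      (y x).2 = β + ∫ t in a..x, c₂ t * (y t).1 := fun x hx => by
    have hs : uIcc a x ⊆ uIcc a b :=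
      uIcc_subset_uIcc left_mem_uIcc (by rwa [uIcc_of_le hab])
    have h := hyx x hx
    rw [intervalIntegral.integral_of_le hx.1, integral_pair] at h
    · rw [intervalIntegral.integral_of_le hx.1, intervalIntegral.integral_of_le hx.1]
      exact ⟨congrArg Prod.fst h, congrArg Prod.snd h⟩
    · exact (intervalIntegrable_iff_integrableOn_Ioc_of_le hx.1).1 (hi1.mono_set hs)
    · exact (intervalIntegrable_iff_integrableOn_Ioc_of_le hx.1).1 (hi2.mono_set hs)
  have key : ∀ {c w v : ℝ → ℂ} (γ : ℂ), IntervalIntegrable (fun t => c t * v t) volume a b →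
      (∀ x ∈ Icc a b, v x = w x) → ∀ᵐ x, x ∈ uIcc a b →
      HasDerivAt (fun x => γ + ∫ t in a..x, c t * v t) (c x * w x) x := fun γ hh hvw => by
    filter_upwards [hh.ae_hasDerivAt_integral] with x h1 h2
    rw [← hvw x (uIcc_of_le hab ▸ h2)]
    exact (h1 h2 a left_mem_uIcc).const_add γ
  have ac : ∀ {h : ℝ → ℂ} (γ : ℂ), IntervalIntegrable h volume a b →
      AbsolutelyContinuousOnInterval (fun x => γ + ∫ t in a..x, h t) a b := fun γ hh =>
    (AbsolutelyContinuousOnInterval.intervalIntegral_of_intervalIntegrable hh).of_dist_le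
      (C := 1) fun x _ y _ => by rw [dist_add_left, one_mul]
  -- The witnesses are the right-hand sides of the integral equations rather than the components of
  -- `y`: absolute continuity and the almost-everywhere derivative are then immediate, and the two
  -- agree on `[a, b]`.
  exact ⟨fun x => α + ∫ t in a..x, c₁ t * (y t).2, fun x => β + ∫ t in a..x, c₂ t * (y t).1,
    ac _ hi1, ac _ hi2, by simp, by simp, key α hi1 fun x h => (hx x h).2,
    key β hi2 fun x h => (hx x h).1⟩

namespace RegularSL

variable {S : RegularSL}

/-! ### Quasi-derivative pairs and solutions -/

theorem ae_weight {P : ℝ → Prop} :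
    (∀ᵐ x ∂S.weight, P x) ↔ ∀ᵐ x ∂(volume.restrict (Ioo S.a S.b)), P x :=
  ⟨fun h => S.absolutelyContinuous_weight.ae_le h,
    fun h => S.weight_absolutelyContinuous.ae_le h⟩

theorem left_mem : S.a ∈ Icc S.a S.b := left_mem_Icc.2 S.a_lt_b.le

theorem right_mem : S.b ∈ Icc S.a S.b := right_mem_Icc.2 S.a_lt_b.le

theorem IsQuasiPair.hasDerivAt {g g₁ : ℝ → ℂ} (h : S.IsQuasiPair g g₁) :
    ∀ᵐ x ∂(volume.restrict (Ioo S.a S.b)), HasDerivAt g (g₁ x / (S.p x : ℂ)) x := by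
  filter_upwards [h.eq, ae_differentiableAt_of_ac h.ac, S.p_pos] with x h1 h2 h3
  have hp : (S.p x : ℂ) ≠ 0 := by exact_mod_cast h3.ne'
  rw [h1, mul_div_cancel_left₀ _ hp]
  exact h2.hasDerivAt

theorem IsQuasiPair.hasDerivAt_quasi {g g₁ : ℝ → ℂ} (h : S.IsQuasiPair g g₁) :
    ∀ᵐ x ∂(volume.restrict (Ioo S.a S.b)),
      HasDerivAt g₁ ((S.q x : ℂ) * g x - (S.r x : ℂ) * S.tau g g₁ x) x := by
  filter_upwards [ae_differentiableAt_of_ac h.ac₁, S.r_pos] with x h2 h3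
  have hr : (S.r x : ℂ) ≠ 0 := by exact_mod_cast h3.ne'
  convert! h2.hasDerivAt using 1
  rw [tau]
  field_simp
  ring

/-- The difference is continuous and vanishes almost everywhere, hence everywhere, and its
quasi-derivative with it. This makes boundary values well defined on `L²`-classes. -/
theorem IsQuasiPair.eqOn_of_ae_eq {g g₁ k k₁ : ℝ → ℂ} (h : S.IsQuasiPair g g₁)
    (h' : S.IsQuasiPair k k₁) (he : g =ᵐ[S.weight] k) :
    EqOn g k (Icc S.a S.b) ∧ EqOn g₁ k₁ (Icc S.a S.b) := by
  have h0 := (h.add (h'.smul (-1))).eqOn_zero (by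
    filter_upwards [ae_weight.1 he] with x hx
    simp [hx])
  constructor
  · intro x hx
    have := h0.1 hx
    simp only [Pi.add_apply, Pi.smul_apply, smul_eq_mul, Pi.zero_apply] at this
    linear_combination this
  · intro x hx
    have := h0.2 hx
    simp only [Pi.add_apply, Pi.smul_apply, smul_eq_mul, Pi.zero_apply] at this
    linear_combination this

theorem IsSolution.add {z : ℂ} {g g₁ k k₁ : ℝ → ℂ} (h : S.IsSolution z g g₁)
    (h' : S.IsSolution z k k₁) : S.IsSolution z (g + k) (g₁ + k₁) := by
  refine ⟨h.1.add h'.1, ?_⟩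
  filter_upwards [h.1.tau_add h'.1, h.2, h'.2] with x h1 h2 h3
  rw [h1, h2, h3, Pi.add_apply]; ring

theorem IsSolution.smul {z : ℂ} {g g₁ : ℝ → ℂ} (c : ℂ) (h : S.IsSolution z g g₁) :
    S.IsSolution z (c • g) (c • g₁) := by
  refine ⟨h.1.smul c, ?_⟩
  filter_upwards [h.1.tau_smul c, h.2] with x h1 h2
  rw [h1, h2, Pi.smul_apply, smul_eq_mul]; ring

theorem deriv_conj_comp (g : ℝ → ℂ) (x : ℝ) :
    deriv (fun t => conj (g t)) x = conj (deriv g x) :=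
  deriv.star

/-- The coefficients are real. -/
theorem IsSolution.conj {z : ℂ} {g g₁ : ℝ → ℂ} (h : S.IsSolution z g g₁) :
    S.IsSolution (conj z) (fun t => conj (g t)) (fun t => conj (g₁ t)) := by
  have hac : ∀ {f : ℝ → ℂ}, AbsolutelyContinuousOnInterval f S.a S.b →
      AbsolutelyContinuousOnInterval (fun t => (starRingEnd ℂ) (f t)) S.a S.b := fun hf =>
    hf.of_dist_le (C := 1) fun x _ y _ => by rw [Complex.dist_conj_conj, one_mul]
  refine ⟨⟨hac h.1.ac, hac h.1.ac₁, ?_⟩, ?_⟩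
  · filter_upwards [h.1.eq] with x hx
    rw [deriv_conj_comp, hx, map_mul, Complex.conj_ofReal]
  · filter_upwards [h.2] with x hx
    rw [← map_mul, ← hx, tau, tau, deriv_conj_comp]
    simp

/-- The initial value problem for `τ u = z u` at the left endpoint is solvable. -/
theorem exists_isSolution (S : RegularSL) (z α β : ℂ) :
    ∃ g g₁, S.IsSolution z g g₁ ∧ g S.a = α ∧ g₁ S.a = β := by
  have hab := S.a_lt_b.le
  have hi : ∀ {f : ℝ → ℝ}, IntegrableOn f (Ioo S.a S.b) →
      IntervalIntegrable (fun x => (f x : ℂ)) volume S.a S.b := fun hf => by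
    rw [intervalIntegrable_iff_integrableOn_Ioo_of_le hab]
    exact hf.ofReal
  -- The equation as a first-order system: `g' = (1/p) g₁`, `g₁' = (q - z r) g`.
  obtain ⟨g, g₁, ac, ac₁, ha, ha₁, hd, hd₁⟩ := exists_offDiagonal_system hab (hi S.inv_p_int)
    ((hi S.q_int).sub ((hi S.r_int).const_mul z)) α β
  refine ⟨g, g₁, ⟨⟨ac, ac₁, ?_⟩, ?_⟩, ha, ha₁⟩
  · filter_upwards [ae_restrict_Ioo_of_ae_mem_uIcc hab hd, S.p_pos] with x h1 h2
    have hp : (S.p x : ℂ) ≠ 0 := by exact_mod_cast h2.ne'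
    rw [h1.deriv]
    push_cast
    field_simp
  · filter_upwards [ae_restrict_Ioo_of_ae_mem_uIcc hab hd₁, S.r_pos] with x h1 h2
    have hr : (S.r x : ℂ) ≠ 0 := by exact_mod_cast h2.ne'
    rw [tau, h1.deriv]
    field_simp
    ring

/-! ### Square integrability -/

instance : IsFiniteMeasure S.weight :=
  isFiniteMeasure_withDensity_ofReal S.r_int.2

theorem memLp_of_ac {g : ℝ → ℂ} (hg : AbsolutelyContinuousOnInterval g S.a S.b) :
    MemLp g 2 S.weight := by
  obtain ⟨C, hC⟩ := hg.exists_bound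
  have hu : uIcc S.a S.b = Icc S.a S.b := uIcc_of_le S.a_lt_b.le
  have hm : AEStronglyMeasurable g (volume.restrict (Ioo S.a S.b)) :=
    ((hu ▸ hg.continuousOn).mono Ioo_subset_Icc_self).aestronglyMeasurable measurableSet_Ioo
  refine MemLp.of_bound (hm.mono_ac S.weight_absolutelyContinuous) C ?_
  refine ae_weight.2 ?_
  filter_upwards [ae_restrict_mem measurableSet_Ioo] with x hx
  exact hC x (hu ▸ Ioo_subset_Icc_self hx)

theorem coeFn_toL2 {g : ℝ → ℂ} (hg : AbsolutelyContinuousOnInterval g S.a S.b) :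
    (S.toL2 g : ℝ → ℂ) =ᵐ[S.weight] g := by
  rw [toL2, dif_pos (memLp_of_ac hg)]
  exact MemLp.coeFn_toLp _

/-! ### Graphs of the restrictions of the maximal operator -/

/-- The value and the boundary condition come with a priori different representatives of `f`;
uniqueness of the quasi-pair on `[a, b]` merges them. -/
theorem mem_restrictOp_graph {K : Submodule ℂ BData} {f h : S.L2} :
    (f, h) ∈ (S.restrictOp K).graph ↔ ∃ g g₁ : ℝ → ℂ, S.IsQuasiPair g g₁ ∧
      (f : ℝ → ℂ) =ᵐ[S.weight] g ∧ (h : ℝ → ℂ) =ᵐ[S.weight] S.tau g g₁ ∧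
      (((g S.a, g₁ S.a), (g S.b, g₁ S.b)) : BData) ∈ K := by
  have h1 : (f, h) ∈ (S.restrictOp K).graph ↔ f ∈ S.bdrySubmodule K ∧ (f, h) ∈ S.maxGraph := by
    rw [← maxOp_graph, LinearPMap.mem_graph_iff, LinearPMap.mem_graph_iff]
    constructor
    · rintro ⟨y, rfl, rfl⟩
      exact ⟨y.2.1, ⟨y, y.2.2⟩, rfl, (LinearPMap.domRestrict_apply rfl).symm⟩
    · rintro ⟨hK, y, rfl, rfl⟩
      exact ⟨⟨y, hK, y.2⟩, rfl, LinearPMap.domRestrict_apply rfl⟩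
  rw [h1]
  constructor
  · rintro ⟨⟨g, g₁, hg, hf, hK⟩, k, k₁, hk, hf', hh⟩
    obtain ⟨e, e₁⟩ := hg.eqOn_of_ae_eq hk (hf.symm.trans hf')
    rw [e left_mem, e right_mem, e₁ left_mem, e₁ right_mem] at hK
    exact ⟨k, k₁, hk, hf', hh, hK⟩
  · rintro ⟨g, g₁, hg, hf, hh, hK⟩
    exact ⟨⟨g, g₁, hg, hf, hK⟩, g, g₁, hg, hf, hh⟩

/-- Both operators restrict `H_max`, so they agree wherever both are defined and only the boundary
data matter. -/
theorem restrictOp_inf (K K' : Submodule ℂ BData) :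
    S.restrictOp K ⊓ S.restrictOp K' = S.restrictOp (K ⊓ K') := by
  refine LinearPMap.eq_of_eq_graph (Submodule.ext ?_)
  rintro ⟨f, h⟩
  have h1 : (f, h) ∈ (S.restrictOp K ⊓ S.restrictOp K').graph ↔
      (f, h) ∈ (S.restrictOp K).graph ∧ (f, h) ∈ (S.restrictOp K').graph := by
    simp only [LinearPMap.mem_graph_iff]
    constructor
    · rintro ⟨⟨y, hy, hy', he⟩, rfl, rfl⟩
      exact ⟨⟨⟨y, hy⟩, rfl, rfl⟩, ⟨⟨y, hy'⟩, rfl, he.symm⟩⟩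
    · rintro ⟨⟨⟨y, hy⟩, rfl, rfl⟩, ⟨⟨y', hy'⟩, e, he⟩⟩
      obtain rfl : y' = y := e
      exact ⟨⟨y', hy, hy', he.symm⟩, rfl, rfl⟩
  rw [h1]
  simp only [mem_restrictOp_graph]
  constructor
  · rintro ⟨⟨g, g₁, hg, hf, hh, hK⟩, k, k₁, hk, hf', -, hK'⟩
    obtain ⟨e, e₁⟩ := hg.eqOn_of_ae_eq hk (hf.symm.trans hf')
    rw [← e left_mem, ← e right_mem, ← e₁ left_mem, ← e₁ right_mem] at hK'
    exact ⟨g, g₁, hg, hf, hh, hK, hK'⟩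
  · rintro ⟨g, g₁, hg, hf, hh, hK, hK'⟩
    exact ⟨⟨g, g₁, hg, hf, hh, hK⟩, g, g₁, hg, hf, hh, hK'⟩

theorem IsSolution.mem_restrictOp_graph {z : ℂ} {g g₁ : ℝ → ℂ} (h : S.IsSolution z g g₁)
    {K : Submodule ℂ BData} (hK : (((g S.a, g₁ S.a), (g S.b, g₁ S.b)) : BData) ∈ K) :
    (S.toL2 g, z • S.toL2 g) ∈ (S.restrictOp K).graph := by
  refine RegularSL.mem_restrictOp_graph.2 ⟨g, g₁, h.1, coeFn_toL2 h.1.ac, ?_, hK⟩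
  filter_upwards [Lp.coeFn_smul z (S.toL2 g), coeFn_toL2 h.1.ac, ae_weight.2 h.2] with x h1 h2 h3
  rw [h1, h3, Pi.smul_apply, h2, smul_eq_mul]

end RegularSL

/-! ### Resolvents and graphs -/

section Resolvent

variable {E : Type*} [NormedAddCommGroup E] [InnerProductSpace ℂ E] {T : E →ₗ.[ℂ] E} {z : ℂ}

theorem isResolventAt_resolv (hz : z ∈ resolvSet T) : IsResolventAt T z (resolv T z) :=
  Classical.epsilon_spec hz

theorem resolv_mem_graph (hz : z ∈ resolvSet T) (f : E) :
    (resolv T z f, f + z • resolv T z f) ∈ T.graph := by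
  obtain ⟨h, he⟩ := (isResolventAt_resolv hz).1 f
  exact LinearPMap.mem_graph_iff _ |>.2 ⟨⟨_, h⟩, rfl, sub_eq_iff_eq_add.1 he⟩

theorem eq_zero_of_mem_graph (hz : z ∈ resolvSet T) {u : E} (hu : (u, z • u) ∈ T.graph) :
    u = 0 := by
  obtain ⟨y, rfl, hy⟩ := (LinearPMap.mem_graph_iff _).1 hu
  have h := (isResolventAt_resolv hz).2 y
  simp only at hy
  rw [hy, sub_self, map_zero] at h
  exact h.symm

theorem mem_kerSub_iff {u : E} : u ∈ kerSub T z ↔ (u, z • u) ∈ T.graph := by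
  rw [LinearPMap.mem_graph_iff]
  constructor
  · rintro ⟨h, h', he⟩
    exact ⟨⟨u, h⟩, rfl, he⟩
  · rintro ⟨y, rfl, he⟩
    exact ⟨y.2, trivial, he⟩

end Resolvent

namespace RegularSL

variable {S : RegularSL}

theorem IsSolution.eqOn_zero_of_mem_resolvSet {z : ℂ} {g g₁ : ℝ → ℂ} (h : S.IsSolution z g g₁)
    {K : Submodule ℂ BData} (hz : z ∈ resolvSet (S.restrictOp K))
    (hK : (((g S.a, g₁ S.a), (g S.b, g₁ S.b)) : BData) ∈ K) : EqOn g 0 (Icc S.a S.b) := by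
  have h0 := eq_zero_of_mem_graph hz (h.mem_restrictOp_graph hK)
  refine eqOn_zero_of_ae h.1.ac (ae_weight.1 ?_)
  filter_upwards [coeFn_toL2 h.1.ac, Lp.coeFn_zero ℂ 2 S.weight] with x h1 h2
  rw [← h1, h0, h2, Pi.zero_apply]

/-! ### The Dirichlet boundary value problem -/

/-- `z` is not a Dirichlet eigenvalue. -/
def DirichletInjective (S : RegularSL) (z : ℂ) : Prop :=
  ∀ g g₁ : ℝ → ℂ, S.IsSolution z g g₁ → g S.a = 0 → g S.b = 0 → EqOn g 0 (Icc S.a S.b)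

theorem dirichletInjective_of_mem_resolvSet {z : ℂ} (hz : z ∈ resolvSet (S.sepOp 0 0)) :
    S.DirichletInjective z := fun _ _ h ha hb =>
  h.eqOn_zero_of_mem_resolvSet hz (by simp [sepBC, ha, hb])

/-- Gives access to `u_j(z̄,·)` without self-adjointness of the Dirichlet operator: injectivity is
all that the construction of the basis needs. -/
theorem DirichletInjective.conj {z : ℂ} (hz : S.DirichletInjective z) :
    S.DirichletInjective (conj z) := fun g g₁ h ha hb x hx => by
  have h' := h.conj
  rw [Complex.conj_conj] at h'
  have := hz _ _ h' (by simp [ha]) (by simp [hb]) hx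
  simpa using this

theorem DirichletInjective.eqOn {z : ℂ} (hz : S.DirichletInjective z) {g g₁ k k₁ : ℝ → ℂ}
    (h : S.IsSolution z g g₁) (h' : S.IsSolution z k k₁) (ha : g S.a = k S.a)
    (hb : g S.b = k S.b) : EqOn g k (Icc S.a S.b) := fun x hx => by
  have := hz _ _ (h.add (h'.smul (-1))) (by simp [ha]) (by simp [hb]) hx
  simp only [Pi.add_apply, Pi.smul_apply, smul_eq_mul, Pi.zero_apply] at this
  linear_combination this

theorem DirichletInjective.bvpSolution_spec {z : ℂ} (hz : S.DirichletInjective z) (α β : ℂ) :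
    S.IsSolution z (S.bvpSolution z α β).1 (S.bvpSolution z α β).2 ∧
      (S.bvpSolution z α β).1 S.a = α ∧ (S.bvpSolution z α β).1 S.b = β := by
  refine Classical.epsilon_spec (p := fun w : (ℝ → ℂ) × (ℝ → ℂ) =>
    S.IsSolution z w.1 w.2 ∧ w.1 S.a = α ∧ w.1 S.b = β) ?_
  obtain ⟨φ, φ₁, hφ, φa, φ₁a⟩ := S.exists_isSolution z 0 1
  obtain ⟨χ, χ₁, hχ, χa, -⟩ := S.exists_isSolution z 1 0
  -- If `φ` vanished at `b`, it would vanish identically, together with its quasi-derivative,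
  -- against `φ₁ a = 1`. So a multiple of `φ` can correct the value at `b` without changing the one
  -- at `a`.
  have hb : φ S.b ≠ 0 := fun hb => by
    have h0 := hz _ _ hφ φa hb
    have h1 := (hφ.1.eqOn_zero (by
      filter_upwards [ae_restrict_mem measurableSet_Ioo] with x hx
      exact h0 (Ioo_subset_Icc_self hx))).2 left_mem
    rw [φ₁a] at h1
    exact one_ne_zero h1
  refine ⟨(α • χ + ((β - α * χ S.b) / φ S.b) • φ, α • χ₁ + ((β - α * χ S.b) / φ S.b) • φ₁),
    (hχ.smul _).add (hφ.smul _), ?_, ?_⟩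
  · simp [φa, χa]
  · simp only [Pi.add_apply, Pi.smul_apply, smul_eq_mul]
    field_simp
    ring

theorem DirichletInjective.isSolution_u {z : ℂ} (hz : S.DirichletInjective z) (j : Fin 2) :
    S.IsSolution z (S.u j z) (S.uQuasi j z) :=
  (hz.bvpSolution_spec _ _).1

theorem DirichletInjective.u_left {z : ℂ} (hz : S.DirichletInjective z) (j : Fin 2) :
    S.u j z S.a = ![0, 1] j :=
  (hz.bvpSolution_spec _ _).2.1

theorem DirichletInjective.u_right {z : ℂ} (hz : S.DirichletInjective z) (j : Fin 2) :
    S.u j z S.b = ![1, 0] j :=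
  (hz.bvpSolution_spec _ _).2.2

/-- Both sides solve the same boundary value problem, whose data are real. This turns inner products
with `u_j(z̄,·)` into integrals against `u_j(z,·)`, to which Green's formula applies. -/
theorem DirichletInjective.eqOn_conj_u {z : ℂ} (hz : S.DirichletInjective z) (j : Fin 2) :
    EqOn (fun x => conj (S.u j (conj z) x)) (S.u j z) (Icc S.a S.b) := by
  have h := (hz.conj.isSolution_u j).conj
  rw [Complex.conj_conj] at h
  refine hz.eqOn h (hz.isSolution_u j) ?_ ?_
  · rw [hz.conj.u_left, hz.u_left]; fin_cases j <;> simp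
  · rw [hz.conj.u_right, hz.u_right]; fin_cases j <;> simp

/-- A solution of `τ y = z y` is the combination of `u_1(z,·)` and `u_2(z,·)` with its boundary
values as coefficients. -/
theorem DirichletInjective.eqOn_combination {z : ℂ} (hz : S.DirichletInjective z) {g g₁ : ℝ → ℂ}
    (h : S.IsSolution z g g₁) :
    EqOn g (g S.b • S.u 0 z + g S.a • S.u 1 z) (Icc S.a S.b) ∧
      EqOn g₁ (g S.b • S.uQuasi 0 z + g S.a • S.uQuasi 1 z) (Icc S.a S.b) := by
  have hc := ((hz.isSolution_u 0).smul (g S.b)).add ((hz.isSolution_u 1).smul (g S.a))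
  have he := hz.eqOn h hc (by simp [hz.u_left]) (by simp [hz.u_right])
  refine h.1.eqOn_of_ae_eq hc.1 (ae_weight.2 ?_)
  filter_upwards [ae_restrict_mem measurableSet_Ioo] with x hx
  exact he (Ioo_subset_Icc_self hx)

theorem DirichletInjective.coeFn_combination {z : ℂ} (hz : S.DirichletInjective z) (c : Fin 2 → ℂ) :
    ((∑ j, c j • S.uL2 j z : S.L2) : ℝ → ℂ) =ᵐ[S.weight] c 0 • S.u 0 z + c 1 • S.u 1 z := by
  rw [Fin.sum_univ_two]
  filter_upwards [Lp.coeFn_add (c 0 • S.uL2 0 z) (c 1 • S.uL2 1 z),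
    Lp.coeFn_smul (c 0) (S.uL2 0 z), Lp.coeFn_smul (c 1) (S.uL2 1 z),
    coeFn_toL2 (hz.isSolution_u 0).1.ac, coeFn_toL2 (hz.isSolution_u 1).1.ac] with x h1 h2 h3 h4 h5
  rw [h1, Pi.add_apply, h2, h3, Pi.smul_apply, Pi.smul_apply, uL2, uL2, h4, h5]
  rfl

theorem DirichletInjective.isSolution_combination {z : ℂ} (hz : S.DirichletInjective z)
    (c : Fin 2 → ℂ) : S.IsSolution z (c 0 • S.u 0 z + c 1 • S.u 1 z)
      (c 0 • S.uQuasi 0 z + c 1 • S.uQuasi 1 z) :=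
  ((hz.isSolution_u 0).smul _).add ((hz.isSolution_u 1).smul _)

theorem DirichletInjective.linearIndependent_uL2 {z : ℂ} (hz : S.DirichletInjective z) :
    LinearIndependent ℂ (fun j => S.uL2 j z) := by
  rw [Fintype.linearIndependent_iff]
  intro c hc
  have h0 := eqOn_zero_of_ae (hz.isSolution_combination c).1.ac (ae_weight.1 (by
    have h1 := hz.coeFn_combination c
    rw [hc] at h1
    filter_upwards [h1, Lp.coeFn_zero ℂ 2 S.weight] with x h2 h3
    rw [← h2, h3, Pi.zero_apply]))
  have ha := h0 left_mem
  have hb := h0 right_mem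
  simp only [Pi.add_apply, Pi.smul_apply, hz.u_left, hz.u_right] at ha hb
  intro j
  fin_cases j
  · simpa using hb
  · simpa using ha

theorem DirichletInjective.span_uL2 {z : ℂ} (hz : S.DirichletInjective z) :
    Submodule.span ℂ (Set.range fun j => S.uL2 j z) = kerSub S.maxOp z := by
  ext f
  rw [Submodule.mem_span_range_iff_exists_fun, mem_kerSub_iff, maxOp_graph]
  constructor
  · rintro ⟨c, rfl⟩
    refine ⟨_, _, (hz.isSolution_combination c).1, hz.coeFn_combination c, ?_⟩
    filter_upwards [Lp.coeFn_smul z (∑ j, c j • S.uL2 j z), hz.coeFn_combination c,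
      ae_weight.2 (hz.isSolution_combination c).2] with x h1 h2 h3
    rw [h3, ← h2]
    exact h1
  · rintro ⟨g, g₁, hg, h1, h2⟩
    have hs : S.IsSolution z g g₁ := by
      refine ⟨hg, ae_weight.1 ?_⟩
      filter_upwards [h1, h2, Lp.coeFn_smul z f] with x h3 h4 h5
      rw [← h4, ← h3]
      exact h5
    -- The value at `b` comes first, since index 0 is the solution equal to 1 at `b`.
    refine ⟨![g S.b, g S.a], Lp.ext ((hz.coeFn_combination _).trans (EventuallyEq.trans ?_ h1.symm))⟩
    refine ae_weight.2 ?_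
    filter_upwards [ae_restrict_mem measurableSet_Ioo] with x hx
    exact ((hz.eqOn_combination hs).1 (Ioo_subset_Icc_self hx)).symm

/-! ### Green's formula -/

theorem integrable_weight_iff {h : ℝ → ℂ} : Integrable h S.weight ↔
    IntervalIntegrable (fun x => (S.r x).toNNReal • h x) volume S.a S.b := by
  rw [intervalIntegrable_iff_integrableOn_Ioo_of_le S.a_lt_b.le]
  exact integrable_withDensity_iff_integrable_smul₀ S.r_int.aemeasurable.real_toNNReal

theorem integral_weight (h : ℝ → ℂ) :
    ∫ x, h x ∂S.weight = ∫ x in S.a..S.b, (S.r x).toNNReal • h x := by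
  rw [intervalIntegral.integral_of_le S.a_lt_b.le, integral_Ioc_eq_integral_Ioo]
  exact integral_withDensity_eq_integral_smul₀ S.r_int.aemeasurable.real_toNNReal h

/-- The Wronskian `w₁ v - w v₁` has derivative `r w (τ v - z v)` almost everywhere: the terms in
`1/p` and in `q` cancel. -/
theorem IsSolution.integral_mul {z : ℂ} {w w₁ v v₁ : ℝ → ℂ} (hw : S.IsSolution z w w₁)
    (hv : S.IsQuasiPair v v₁) {f : S.L2}
    (hf : ∀ᵐ x ∂S.weight, f x = S.tau v v₁ x - z * v x) :
    ∫ x, w x * f x ∂S.weight =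
      (w₁ S.b * v S.b - w S.b * v₁ S.b) - (w₁ S.a * v S.a - w S.a * v₁ S.a) := by
  have hab := S.a_lt_b.le
  have hint : Integrable (fun x => w x * f x) S.weight :=
    (memLp_of_ac hw.1.ac).integrable_mul (Lp.memLp f)
  rw [integral_weight]
  have hG : AbsolutelyContinuousOnInterval (w₁ • v - w • v₁) S.a S.b :=
    (hw.1.ac₁.smul hv.ac).sub (hw.1.ac.smul hv.ac₁)
  have hd : ∀ᵐ x ∂(volume.restrict (Ioo S.a S.b)), HasDerivAt (w₁ • v - w • v₁)
      ((S.r x).toNNReal • (w x * f x)) x := by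
    filter_upwards [hw.1.hasDerivAt, hw.1.hasDerivAt_quasi, hv.hasDerivAt, hv.hasDerivAt_quasi,
      hw.2, ae_weight.1 hf, S.r_pos] with x h1 h2 h3 h4 h5 h6 h7
    rw [h5] at h2
    convert! (h2.smul h3).sub (h1.smul h4) using 1
    rw [h6, NNReal.smul_def, Real.coe_toNNReal _ h7.le]
    simp only [smul_eq_mul, Complex.real_smul]
    ring
  have h := hG.eq_add_integral (integrable_weight_iff.1 hint)
    (ae_mem_uIcc_of_ae_restrict_Ioo hab hd) right_mem_uIcc
  simp only [Pi.sub_apply, smul_eq_mul, Pi.mul_apply] at h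
  linear_combination -h

/-- In Green's formula the terms with endpoint values of `v` drop out, and the 0/1 boundary values
of `u_j` select a single quasi-derivative. -/
theorem DirichletInjective.inner_uL2 {z : ℂ} (hz : S.DirichletInjective z) {v v₁ : ℝ → ℂ}
    (hv : S.IsQuasiPair v v₁) (ha : v S.a = 0) (hb : v S.b = 0) {f : S.L2}
    (hf : ∀ᵐ x ∂S.weight, f x = S.tau v v₁ x - z * v x) :
    inner ℂ (S.uL2 0 (conj z)) f = -v₁ S.b ∧ inner ℂ (S.uL2 1 (conj z)) f = v₁ S.a := by
  have h : ∀ j, inner ℂ (S.uL2 j (conj z)) f =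
      S.u j z S.a * v₁ S.a - S.u j z S.b * v₁ S.b := fun j => by
    rw [L2.inner_def]
    have h1 := (hz.isSolution_u j).integral_mul hv hf
    rw [ha, hb] at h1
    refine Eq.trans (integral_congr_ae ?_) (h1.trans (by ring))
    filter_upwards [coeFn_toL2 (hz.conj.isSolution_u j).1.ac,
      ae_weight.2 (ae_restrict_mem measurableSet_Ioo)] with x h2 h3
    rw [uL2, h2, RCLike.inner_apply, ← hz.eqOn_conj_u j (Ioo_subset_Icc_self h3)]
    ring
  rw [h, h, hz.u_left, hz.u_right, hz.u_left, hz.u_right]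
  simp

/-! ### Krein's resolvent formula -/

/-- Boundary data of the combination `c₀ u_1(z,·) + c₁ u_2(z,·)`, whose quasi-derivatives are
shifted by `s` at `a` and by `t` at `b`. -/
def combinationData (S : RegularSL) (z : ℂ) (c : Fin 2 → ℂ) (s t : ℂ) : BData :=
  ((c 1, s + (c 0 * S.uQuasi 0 z S.a + c 1 * S.uQuasi 1 z S.a)),
    (c 0, t + (c 0 * S.uQuasi 0 z S.b + c 1 * S.uQuasi 1 z S.b)))

/-- The combination lies in the kernel of an injective operator, so it vanishes; its endpoint values
are the coefficients. -/
theorem eq_zero_of_combinationData_mem {z : ℂ} {K : Submodule ℂ BData}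
    (hz : z ∈ resolvSet (S.restrictOp K)) (h0 : z ∈ resolvSet (S.sepOp 0 0)) {c : Fin 2 → ℂ}
    (hc : S.combinationData z c 0 0 ∈ K) : c = 0 := by
  have hD := dirichletInjective_of_mem_resolvSet h0
  have h := (hD.isSolution_combination c).eqOn_zero_of_mem_resolvSet hz (by
    simpa [combinationData, hD.u_left, hD.u_right] using hc)
  have ha := h left_mem
  have hb := h right_mem
  simp only [Pi.add_apply, Pi.smul_apply, hD.u_left, hD.u_right] at ha hb
  ext j
  fin_cases j
  · simpa using hb
  · simpa using ha

theorem exists_resolv_eq {z : ℂ} {K : Submodule ℂ BData}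
    (hz : z ∈ resolvSet (S.restrictOp K)) (h0 : z ∈ resolvSet (S.sepOp 0 0)) (f : S.L2) :
    ∃ c : Fin 2 → ℂ,
      resolv (S.restrictOp K) z f = resolv (S.sepOp 0 0) z f + ∑ j, c j • S.uL2 j z ∧
      S.combinationData z c (inner ℂ (S.uL2 1 (conj z)) f) (-inner ℂ (S.uL2 0 (conj z)) f) ∈ K := by
  have hD := dirichletInjective_of_mem_resolvSet h0
  obtain ⟨g, g₁, hg, eg, tg, hK⟩ := mem_restrictOp_graph.1 (resolv_mem_graph hz f)
  obtain ⟨v, v₁, hv, ev, tv, hv0⟩ := mem_restrictOp_graph.1 (resolv_mem_graph h0 f)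
  set G := resolv (S.restrictOp K) z f
  set V := resolv (S.sepOp 0 0) z f
  have va : v S.a = 0 := by simpa using hv0.1
  have vb : v S.b = 0 := by simpa using hv0.2
  have shift : ∀ {F : S.L2} {k k₁ : ℝ → ℂ}, (F : ℝ → ℂ) =ᵐ[S.weight] k →
      ((f + z • F : S.L2) : ℝ → ℂ) =ᵐ[S.weight] S.tau k k₁ →
      ∀ᵐ x ∂S.weight, f x = S.tau k k₁ x - z * k x := fun {F k k₁} e t => by
    filter_upwards [e, t, Lp.coeFn_add f (z • F), Lp.coeFn_smul z F] with x h1 h2 h3 h4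
    rw [← h1, ← h2, h3, Pi.add_apply, h4, Pi.smul_apply, smul_eq_mul]
    ring
  have fg := shift eg tg
  have fv := shift ev tv
  -- The source `f` cancels in the difference of the two resolvents.
  have hw : S.IsSolution z (g + (-1 : ℂ) • v) (g₁ + (-1 : ℂ) • v₁) := by
    refine ⟨hg.add (hv.smul _), ?_⟩
    filter_upwards [hg.tau_add (hv.smul (-1)), hv.tau_smul (-1), ae_weight.1 fg,
      ae_weight.1 fv] with x h1 h2 h3 h4
    rw [h1, h2, Pi.add_apply, Pi.smul_apply, smul_eq_mul]
    linear_combination h4 - h3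
  obtain ⟨e, e₁⟩ := hD.eqOn_combination hw
  have wa : (g + (-1 : ℂ) • v) S.a = g S.a := by simp [va]
  have wb : (g + (-1 : ℂ) • v) S.b = g S.b := by simp [vb]
  rw [wa, wb] at e e₁
  refine ⟨![g S.b, g S.a], ?_, ?_⟩
  · refine Lp.ext ?_
    filter_upwards [eg, ev, Lp.coeFn_add V (∑ j, (![g S.b, g S.a] : Fin 2 → ℂ) j • S.uL2 j z),
      hD.coeFn_combination ![g S.b, g S.a],
      ae_weight.2 (ae_restrict_mem measurableSet_Ioo)] with x h1 h2 h3 h4 h5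
    have h6 := e (Ioo_subset_Icc_self h5)
    rw [h3, Pi.add_apply, h4, h1, h2]
    simp only [Pi.add_apply, Pi.smul_apply, smul_eq_mul, Matrix.cons_val_zero,
      Matrix.cons_val_one] at h6 ⊢
    linear_combination h6
  · obtain ⟨i0, i1⟩ := hD.inner_uL2 hv va vb fv
    have ea := e₁ left_mem
    have eb := e₁ right_mem
    simp only [Pi.add_apply, Pi.smul_apply, smul_eq_mul] at ea eb
    convert! hK using 1
    simp only [combinationData, i0, i1, Matrix.cons_val_zero, Matrix.cons_val_one, neg_neg,
      ← ea, ← eb]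
    congr 2 <;> ring

/-! ### Separated boundary conditions in cotangent form and the three resolvent formulas -/

theorem mem_sepBC_iff {θa θb : ℝ} {v : BData} : v ∈ sepBC θa θb ↔
    (Real.cos θa : ℂ) * v.1.1 + (Real.sin θa : ℂ) * v.1.2 = 0 ∧
    (Real.cos θb : ℂ) * v.2.1 - (Real.sin θb : ℂ) * v.2.2 = 0 :=
  Iff.rfl

theorem cos_mul_add_sin_mul_eq_zero_iff {θ : ℝ} (hθ : Real.sin θ ≠ 0) (x y : ℂ) :
    (Real.cos θ : ℂ) * x + (Real.sin θ : ℂ) * y = 0 ↔ (Real.cot θ : ℂ) * x + y = 0 := by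
  have hs : (Real.sin θ : ℂ) ≠ 0 := by exact_mod_cast hθ
  rw [Real.cot_eq_cos_div_sin, Complex.ofReal_div]
  have : (Real.cos θ : ℂ) * x + (Real.sin θ : ℂ) * y =
      (Real.sin θ : ℂ) * ((Real.cos θ : ℂ) / (Real.sin θ : ℂ) * x + y) := by
    field_simp
  rw [this, mul_eq_zero, or_iff_right hs]

theorem cos_mul_sub_sin_mul_eq_zero_iff {θ : ℝ} (hθ : Real.sin θ ≠ 0) (x y : ℂ) :
    (Real.cos θ : ℂ) * x - (Real.sin θ : ℂ) * y = 0 ↔ (Real.cot θ : ℂ) * x - y = 0 := by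
  have := cos_mul_add_sin_mul_eq_zero_iff hθ x (-y)
  rwa [mul_neg, ← sub_eq_add_neg, ← sub_eq_add_neg] at this

theorem sin_ne_zero_of_mem_Ico {θ : ℝ} (h : θ ∈ Set.Ico 0 Real.pi) (h0 : θ ≠ 0) :
    Real.sin θ ≠ 0 :=
  (Real.sin_pos_of_pos_of_lt_pi (lt_of_le_of_ne h.1 h0.symm) h.2).ne'

theorem maxCommonPart_sepOp {θa θb : ℝ} {K : Submodule ℂ BData}
    (h : ∀ v : BData, v ∈ sepBC θa θb ∧ v.1.1 = 0 ∧ v.2.1 = 0 ↔ v ∈ K) :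
    maxCommonPart (S.sepOp θa θb) (S.sepOp 0 0) = S.restrictOp K := by
  rw [maxCommonPart, sepOp, sepOp, restrictOp_inf]
  congr 1
  ext v
  rw [← h, Submodule.mem_inf, mem_sepBC_iff (θa := 0)]
  simp

theorem krein_two_dim {θa θb : ℝ} (ha : Real.sin θa ≠ 0) (hb : Real.sin θb ≠ 0) {z : ℂ}
    (hz : z ∈ resolvSet (S.sepOp θa θb)) (h0 : z ∈ resolvSet (S.sepOp 0 0)) :
    IsUnit (S.D θa θb z) ∧
      resolv (S.sepOp θa θb) z = resolv (S.sepOp 0 0) z -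
        ∑ j, ∑ k, (S.D θa θb z)⁻¹ j k •
          InnerProductSpace.rankOne ℂ (S.uL2 j z) (S.uL2 k (conj z)) := by
  -- The first row of `D` is the condition at `b`, the second the one at `a`. Zero shifts give
  -- invertibility of `D`; the shifts coming from the Dirichlet resolvent give the formula.
  have hmem : ∀ (c : Fin 2 → ℂ) (s t : ℂ), S.combinationData z c s t ∈ sepBC θa θb ↔
      Matrix.mulVec (S.D θa θb z) c = ![t, -s] := fun c s t => by
    rw [mem_sepBC_iff, cos_mul_add_sin_mul_eq_zero_iff ha, cos_mul_sub_sin_mul_eq_zero_iff hb]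
    simp only [combinationData, D, funext_iff, Fin.forall_fin_two, Matrix.mulVec, dotProduct,
      Fin.sum_univ_two, Matrix.of_apply, Matrix.cons_val', Matrix.cons_val_zero,
      Matrix.cons_val_one, Matrix.cons_val_fin_one]
    constructor
    · rintro ⟨h1, h2⟩
      exact ⟨by linear_combination h2, by linear_combination h1⟩
    · rintro ⟨h1, h2⟩
      exact ⟨by linear_combination h2, by linear_combination h1⟩
  have hU : IsUnit (S.D θa θb z) := by
    rw [← Matrix.mulVec_injective_iff_isUnit]
    refine (injective_iff_map_eq_zero (Matrix.mulVecLin (S.D θa θb z))).2 fun c hc => ?_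
    refine eq_zero_of_combinationData_mem hz h0 ((hmem c 0 0).2 ?_)
    rw [Matrix.mulVecLin_apply] at hc
    rw [hc]
    ext j
    fin_cases j <;> simp
  refine ⟨hU, ContinuousLinearMap.ext fun f => ?_⟩
  obtain ⟨c, hc, hK⟩ := exists_resolv_eq hz h0 f
  have hdet := (Matrix.isUnit_iff_isUnit_det _).1 hU
  have hc' : c = Matrix.mulVec (S.D θa θb z)⁻¹
      (fun k => -inner ℂ (S.uL2 k (conj z)) f) := by
    have h1 := (hmem _ _ _).1 hK
    rw [← Matrix.one_mulVec c, ← Matrix.nonsing_inv_mul _ hdet, ← Matrix.mulVec_mulVec, h1]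
    congr 1
    ext j
    fin_cases j <;> simp
  have hR : resolv (S.sepOp θa θb) z f = _ := hc
  rw [hR, sub_eq_add_neg, add_apply, neg_apply, hc']
  congr 1
  simp only [Fin.sum_univ_two, Matrix.mulVec, dotProduct, add_apply,
    smul_apply, InnerProductSpace.rankOne_apply]
  module

/-- The Dirichlet condition at `b` forces the coefficient of `u_1` to vanish, so the correction has
rank one. -/
theorem krein_left {θa : ℝ} (ha : Real.sin θa ≠ 0) {z : ℂ}
    (hz : z ∈ resolvSet (S.sepOp θa 0)) (h0 : z ∈ resolvSet (S.sepOp 0 0)) :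
    S.dLeft θa z ≠ 0 ∧
      resolv (S.sepOp θa 0) z = resolv (S.sepOp 0 0) z -
        (S.dLeft θa z)⁻¹ • InnerProductSpace.rankOne ℂ (S.uL2 1 z) (S.uL2 1 (conj z)) := by
  have hmem : ∀ (c : Fin 2 → ℂ) (s t : ℂ), S.combinationData z c s t ∈ sepBC θa 0 ↔
      c 0 = 0 ∧ S.dLeft θa z * c 1 = -s := fun c s t => by
    rw [mem_sepBC_iff, cos_mul_add_sin_mul_eq_zero_iff ha]
    simp only [combinationData, dLeft, Real.cos_zero, Real.sin_zero, Complex.ofReal_one,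
      Complex.ofReal_zero, one_mul, zero_mul, sub_zero]
    constructor
    · rintro ⟨h1, h2⟩
      exact ⟨h2, by linear_combination h1 - S.uQuasi 0 z S.a * h2⟩
    · rintro ⟨h1, h2⟩
      exact ⟨by linear_combination h2 + S.uQuasi 0 z S.a * h1, h1⟩
  have hU : S.dLeft θa z ≠ 0 := fun hd => by
    -- If the scalar were zero, `u_2(z,·)` itself would satisfy both boundary conditions.
    have h := eq_zero_of_combinationData_mem hz h0 ((hmem ![0, 1] 0 0).2 (by simp [hd]))
    simpa using congrFun h 1
  refine ⟨hU, ContinuousLinearMap.ext fun f => ?_⟩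
  obtain ⟨c, hc, hK⟩ := exists_resolv_eq hz h0 f
  obtain ⟨c0, c1⟩ := (hmem _ _ _).1 hK
  have c1' : c 1 = -((S.dLeft θa z)⁻¹ * inner ℂ (S.uL2 1 (conj z)) f) := by
    rw [← mul_neg, ← c1, inv_mul_cancel_left₀ hU]
  have hR : resolv (S.sepOp θa 0) z f = _ := hc
  rw [hR, sub_eq_add_neg, add_apply, neg_apply]
  congr 1
  rw [Fin.sum_univ_two, c0, c1', smul_apply,
    InnerProductSpace.rankOne_apply]
  module

theorem krein_right {θb : ℝ} (hb : Real.sin θb ≠ 0) {z : ℂ}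
    (hz : z ∈ resolvSet (S.sepOp 0 θb)) (h0 : z ∈ resolvSet (S.sepOp 0 0)) :
    S.dRight θb z ≠ 0 ∧
      resolv (S.sepOp 0 θb) z = resolv (S.sepOp 0 0) z -
        (S.dRight θb z)⁻¹ • InnerProductSpace.rankOne ℂ (S.uL2 0 z) (S.uL2 0 (conj z)) := by
  have hmem : ∀ (c : Fin 2 → ℂ) (s t : ℂ), S.combinationData z c s t ∈ sepBC 0 θb ↔
      c 1 = 0 ∧ S.dRight θb z * c 0 = t := fun c s t => by
    rw [mem_sepBC_iff, cos_mul_sub_sin_mul_eq_zero_iff hb]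
    simp only [combinationData, dRight, Real.cos_zero, Real.sin_zero, Complex.ofReal_one,
      Complex.ofReal_zero, one_mul, zero_mul, add_zero]
    constructor
    · rintro ⟨h1, h2⟩
      exact ⟨h1, by linear_combination h2 + S.uQuasi 1 z S.b * h1⟩
    · rintro ⟨h1, h2⟩
      exact ⟨h1, by linear_combination h2 - S.uQuasi 1 z S.b * h1⟩
  have hU : S.dRight θb z ≠ 0 := fun hd => by
    -- Here `u_1(z,·)` would be the forbidden eigenfunction.
    have h := eq_zero_of_combinationData_mem hz h0 ((hmem ![1, 0] 0 0).2 (by simp [hd]))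
    simpa using congrFun h 0
  refine ⟨hU, ContinuousLinearMap.ext fun f => ?_⟩
  obtain ⟨c, hc, hK⟩ := exists_resolv_eq hz h0 f
  obtain ⟨c1, c0⟩ := (hmem _ _ _).1 hK
  have c0' : c 0 = -((S.dRight θb z)⁻¹ * inner ℂ (S.uL2 0 (conj z)) f) := by
    rw [← mul_neg, ← c0, inv_mul_cancel_left₀ hU]
  have hR : resolv (S.sepOp 0 θb) z f = _ := hc
  rw [hR, sub_eq_add_neg, add_apply, neg_apply]
  congr 1
  rw [Fin.sum_univ_two, c1, c0', smul_apply,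
    InnerProductSpace.rankOne_apply]
  module

end RegularSL

end

theorem theoremt3p1 (S : RegularSL) :
    -- the basis `u_1(z,·), u_2(z,·)` of `ker (H_max - z I)`, normalized by its boundary values
    (∀ z ∈ resolvSet (S.sepOp 0 0),
      (∀ j, S.IsSolution z (S.u j z) (S.uQuasi j z)) ∧
      S.u 0 z S.a = 0 ∧ S.u 0 z S.b = 1 ∧ S.u 1 z S.a = 1 ∧ S.u 1 z S.b = 0 ∧
      LinearIndependent ℂ (fun j => S.uL2 j z) ∧
      Submodule.span ℂ (Set.range fun j => S.uL2 j z) = kerSub S.maxOp z) ∧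
    -- (i)
    (∀ θa ∈ Set.Ico 0 Real.pi, ∀ θb ∈ Set.Ico 0 Real.pi, θa ≠ 0 → θb ≠ 0 →
      maxCommonPart (S.sepOp θa θb) (S.sepOp 0 0) = S.minOp ∧
      ∀ z ∈ resolvSet (S.sepOp θa θb) ∩ resolvSet (S.sepOp 0 0),
        IsUnit (S.D θa θb z) ∧
        resolv (S.sepOp θa θb) z = resolv (S.sepOp 0 0) z -
          ∑ j, ∑ k, (S.D θa θb z)⁻¹ j k •
            InnerProductSpace.rankOne ℂ (S.uL2 j z) (S.uL2 k ((starRingEnd ℂ) z))) ∧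
    -- (ii)
    (∀ θa ∈ Set.Ico 0 Real.pi, θa ≠ 0 →
      maxCommonPart (S.sepOp θa 0) (S.sepOp 0 0) = S.tildeMinOp ∧
      ∀ z ∈ resolvSet (S.sepOp θa 0) ∩ resolvSet (S.sepOp 0 0),
        S.dLeft θa z ≠ 0 ∧
        resolv (S.sepOp θa 0) z = resolv (S.sepOp 0 0) z -
          (S.dLeft θa z)⁻¹ •
            InnerProductSpace.rankOne ℂ (S.uL2 1 z) (S.uL2 1 ((starRingEnd ℂ) z))) ∧
    -- (iii)
    (∀ θb ∈ Set.Ico 0 Real.pi, θb ≠ 0 →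
      maxCommonPart (S.sepOp 0 θb) (S.sepOp 0 0) = S.hatMinOp ∧
      ∀ z ∈ resolvSet (S.sepOp 0 θb) ∩ resolvSet (S.sepOp 0 0),
        S.dRight θb z ≠ 0 ∧
        resolv (S.sepOp 0 θb) z = resolv (S.sepOp 0 0) z -
          (S.dRight θb z)⁻¹ •
            InnerProductSpace.rankOne ℂ (S.uL2 0 z) (S.uL2 0 ((starRingEnd ℂ) z))) := by
  refine ⟨fun z hz => ?_, fun θa ha θb hb ha0 hb0 => ?_, fun θa ha ha0 => ?_, fun θb hb hb0 => ?_⟩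
  · have hD := RegularSL.dirichletInjective_of_mem_resolvSet hz
    exact ⟨hD.isSolution_u, hD.u_left 0, hD.u_right 0, hD.u_left 1, hD.u_right 1,
      hD.linearIndependent_uL2, hD.span_uL2⟩
  · have sa := RegularSL.sin_ne_zero_of_mem_Ico ha ha0
    have sb := RegularSL.sin_ne_zero_of_mem_Ico hb hb0
    refine ⟨RegularSL.maxCommonPart_sepOp fun v => ?_, fun z hz =>
      RegularSL.krein_two_dim sa sb hz.1 hz.2⟩
    rw [RegularSL.mem_sepBC_iff, RegularSL.cos_mul_add_sin_mul_eq_zero_iff sa,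
      RegularSL.cos_mul_sub_sin_mul_eq_zero_iff sb, Submodule.mem_bot, Prod.ext_iff,
      Prod.ext_iff, Prod.ext_iff]
    constructor
    · rintro ⟨⟨h1, h2⟩, h3, h4⟩
      exact ⟨⟨h3, by simpa [h3] using h1⟩, h4, by simpa [h4] using h2⟩
    · rintro ⟨⟨h1, h2⟩, h3, h4⟩
      simp_all
  · have sa := RegularSL.sin_ne_zero_of_mem_Ico ha ha0
    refine ⟨RegularSL.maxCommonPart_sepOp fun v => ?_, fun z hz =>
      RegularSL.krein_left sa hz.1 hz.2⟩
    rw [RegularSL.mem_sepBC_iff, RegularSL.cos_mul_add_sin_mul_eq_zero_iff sa]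
    constructor
    · rintro ⟨⟨h1, -⟩, h3, h4⟩
      exact ⟨h4, h3, by simpa [h3] using h1⟩
    · rintro ⟨h1, h2, h3⟩
      simp [h1, h2, h3]
  · have sb := RegularSL.sin_ne_zero_of_mem_Ico hb hb0
    refine ⟨RegularSL.maxCommonPart_sepOp fun v => ?_, fun z hz =>
      RegularSL.krein_right sb hz.1 hz.2⟩
    rw [RegularSL.mem_sepBC_iff, RegularSL.cos_mul_sub_sin_mul_eq_zero_iff sb]
    constructor
    · rintro ⟨⟨-, h2⟩, h3, h4⟩
      exact ⟨h4, h3, by simpa [h4] using h2⟩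
    · rintro ⟨h1, h2, h3⟩
      simp [h1, h2, h3]
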